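/- Let $p\ge 5$ be a prime, let $\Omega$ be a set of size $3p$, and let $G\le\mathrm{Sym}(\Omega)$ be a primitive permutation group which is not $2$-transitive. Let $\pi$ be the permutation character of $G$, i.e. the complex character of the representation of $G$ by permutation matrices, so that $\pi(g)$ is the number of fixed points of $g$ in $\Omega$. Then there do not exist irreducible complex characters $\chi_1,\chi_2$ of $G$, both of degree $(3p-1)/2$, such that $\pi=1_G+\chi_1+\chi_2$, where $1_G$ is the principal character of $G$. -/

import Mathlib

/-- The permutation character `π` of a permutation group `G` on `Ω`: the trace of the permutation
matrices of the elements of `G`, over `ℂ`. -/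
noncomputable def permutationCharacter {Ω : Type*} (G : Subgroup (Equiv.Perm Ω)) : G → ℂ :=
  (Representation.ofMulAction ℂ G Ω).character

/-- `χ` is an irreducible complex character of `G`: the character of an irreducible
finite-dimensional complex representation (by a choice of basis the space may be taken
to be `ℂⁿ`). -/
def IsIrreducibleCharacter {G : Type*} [Group G] (χ : G → ℂ) : Prop :=
  ∃ (n : ℕ) (ρ : Representation ℂ G (Fin n → ℂ)), ρ.IsIrreducible ∧ ρ.character = χ

/-! Suppose `π = 1 + χ₁ + χ₂` as excluded. If `χ₁ ≠ χ₂`, an orbital matrix `M` of valency `k` acts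
on the constituents as scalars `k`, `r`, `s`. Since `tr M = 0`, `r + s = -2k/(3p - 1)`; this is an
algebraic integer, so `r + s = -1` and `2k = 3p - 1`. Then `tr M²` gives `(r - s)² = ±3p`.

Some `g` of `p`-power order has no fixed point, so `χ₁(g) + χ₂(g) = -1`. If `T` is the number of `x`
with `(x, gx)` in the orbital, the trace of `M g` gives `2T - 3p = (r - s)(χ₁(g) - χ₂(g))`. The left
side is odd and at most `3p` in absolute value. The right side is `√(±3p)` times a sum of roots of
unity of order prime to `3`. As `3` is unramified in the field of those roots, this forces `9p ∣ 2T
- 3p`, which is absurd. The ramification argument is carried by `IsFrobeniusFixed`: a power of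
Frobenius fixes such sums modulo `3`. -/

theorem Complex.exists_int_eq_of_isIntegral_ratCast {r : ℚ} (h : IsIntegral ℤ (r : ℂ)) :
    ∃ d : ℤ, r = d := by
  have h' : IsIntegral ℤ (algebraMap ℚ ℂ r) := by simpa using h
  rw [isIntegral_algebraMap_iff (algebraMap ℚ ℂ).injective] at h'
  obtain ⟨d, hd⟩ := IsIntegrallyClosed.isIntegral_iff.mp h'
  exact ⟨d, by simpa using hd.symm⟩

/-- `x` is an algebraic integer which the `q`-power map fixes modulo `3`. -/
def IsFrobeniusFixed (q : ℕ) (x : ℂ) : Prop :=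
  IsIntegral ℤ x ∧ ∃ z : ℂ, IsIntegral ℤ z ∧ x ^ q = x + 3 * z

/-! ### Algebraic integers fixed by Frobenius modulo 3 -/

namespace IsFrobeniusFixed

variable {m k : ℕ} {x y : ℂ}

theorem of_pow_eq_one (hm : m ≠ 0) (hx : x ^ m = 1) (hk : 3 ^ k ≡ 1 [MOD m]) :
    IsFrobeniusFixed (3 ^ k) x := by
  refine ⟨IsIntegral.of_pow (Nat.pos_of_ne_zero hm) (by rw [hx]; exact isIntegral_one),
    0, isIntegral_zero, ?_⟩
  have h1 : 1 ≤ 3 ^ k := Nat.one_le_pow _ _ (by norm_num)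
  obtain ⟨c, hc⟩ := (Nat.modEq_iff_dvd' h1).mp hk.symm
  have : 3 ^ k = m * c + 1 := by omega
  rw [this, pow_succ, pow_mul, hx]
  simp

theorem zero : IsFrobeniusFixed (3 ^ k) 0 :=
  ⟨isIntegral_zero, 0, isIntegral_zero, by simp⟩

theorem add (hx : IsFrobeniusFixed (3 ^ k) x) (hy : IsFrobeniusFixed (3 ^ k) y) :
    IsFrobeniusFixed (3 ^ k) (x + y) := by
  obtain ⟨hx, u, hu, hxu⟩ := hx
  obtain ⟨hy, v, hv, hyv⟩ := hy
  obtain ⟨r, hr⟩ := exists_add_pow_prime_pow_eq Nat.prime_three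
    (⟨x, hx⟩ : integralClosure ℤ ℂ) ⟨y, hy⟩ k
  have hr' := congrArg (algebraMap (integralClosure ℤ ℂ) ℂ) hr
  simp only [map_add, map_pow, map_mul, map_natCast] at hr'
  change (x + y) ^ 3 ^ k = x ^ 3 ^ k + y ^ 3 ^ k + (3 : ℕ) * x * y * (r : ℂ) at hr'
  refine ⟨hx.add hy, u + v + x * y * r, (hu.add hv).add ((hx.mul hy).mul r.2), ?_⟩
  rw [hr', hxu, hyv]
  push_cast
  ring

theorem neg (hx : IsFrobeniusFixed (3 ^ k) x) : IsFrobeniusFixed (3 ^ k) (-x) := by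
  obtain ⟨hx, u, hu, hxu⟩ := hx
  refine ⟨hx.neg, -u, hu.neg, ?_⟩
  rw [Odd.neg_pow (Odd.pow (by decide)), hxu]
  ring

theorem sub (hx : IsFrobeniusFixed (3 ^ k) x) (hy : IsFrobeniusFixed (3 ^ k) y) :
    IsFrobeniusFixed (3 ^ k) (x - y) := by
  rw [sub_eq_add_neg]
  exact hx.add hy.neg

theorem multiset_sum {s : Multiset ℂ} (h : ∀ x ∈ s, IsFrobeniusFixed (3 ^ k) x) :
    IsFrobeniusFixed (3 ^ k) s.sum := by
  induction s using Multiset.induction with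
  | empty => simpa using zero
  | cons a s ih =>
    rw [Multiset.sum_cons]
    exact (h a (by simp)).add (ih fun x hx => h x (by simp [hx]))

/-- The trace of an endomorphism of finite order prime to `3` is fixed modulo `3` by a power of
the Frobenius map. -/
theorem trace {V : Type*} [AddCommGroup V] [Module ℂ V] [FiniteDimensional ℂ V]
    {f : Module.End ℂ V} (hm : m ≠ 0) (hf : f ^ m = 1) (hk : 3 ^ k ≡ 1 [MOD m]) :
    IsFrobeniusFixed (3 ^ k) (LinearMap.trace ℂ V f) := by
  rw [Module.End.trace_eq_sum_roots_charpoly_of_splits (IsAlgClosed.splits _)]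
  refine multiset_sum fun x hx => of_pow_eq_one hm ?_ hk
  have hx' := (Polynomial.mem_roots'.mp hx).2
  rw [← Module.End.hasEigenvalue_iff_isRoot_charpoly] at hx'
  obtain ⟨v, hv⟩ := hx'.exists_hasEigenvector
  have h1 := hv.pow_apply m
  rw [hf, Module.End.one_apply] at h1
  have h2 : (x ^ m - 1) • v = 0 := by rw [sub_smul, ← h1, one_smul, sub_self]
  exact sub_eq_zero.mp ((smul_eq_zero.mp h2).resolve_right hv.2)

/-- `±3 p` times a nonzero square that is fixed modulo `3` is not the square of a small integer. -/
theorem false_of_sq_eq {p : ℕ} (hp : p.Prime) (hp3 : p ≠ 3) (hk : k ≠ 0) {N ε : ℤ}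
    (hε : ε ^ 2 = 1) (hN0 : N ≠ 0) (hN : |N| ≤ 3 * p) (hx : IsFrobeniusFixed (3 ^ k) x)
    (h : (N : ℂ) ^ 2 = ε * (3 * p) * x ^ 2) : False := by
  obtain ⟨hx, z, hz, hxz⟩ := hx
  have hp0 : (p : ℂ) ≠ 0 := by exact_mod_cast hp.ne_zero
  have hpq0 : (p : ℚ) ≠ 0 := by exact_mod_cast hp.ne_zero
  have hεc : (ε : ℂ) ^ 2 = 1 := by exact_mod_cast hε
  have hx2 : x ^ 2 = ((ε * N ^ 2 / (3 * p) : ℚ) : ℂ) := by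
    push_cast
    rw [h]
    field_simp
    linear_combination (-x ^ 2) * hεc
  obtain ⟨d, hd⟩ := Complex.exists_int_eq_of_isIntegral_ratCast (hx2 ▸ hx.pow 2)
  have hxd : x ^ 2 = d := by rw [hx2, hd]; simp
  have hNd : N ^ 2 = ε * (3 * p) * d := by
    have : (N : ℂ) ^ 2 = ε * (3 * p) * d := by rw [h, hxd]
    exact_mod_cast this
  have h3 : Prime (3 : ℤ) := Int.prime_three
  have hpz : Prime (p : ℤ) := Nat.prime_iff_prime_int.mp hp
  have h3p : ¬ (3 : ℤ) ∣ p := by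
    intro hdvd
    have : 3 ∣ p := by exact_mod_cast hdvd
    exact hp3 ((Nat.prime_dvd_prime_iff_eq Nat.prime_three hp).mp this).symm
  have h3ε : ¬ (3 : ℤ) ∣ ε := by
    intro hdvd
    have : (3 : ℤ) ∣ 1 := hε ▸ dvd_pow hdvd two_ne_zero
    omega
  obtain ⟨M, rfl⟩ : (3 : ℤ) ∣ N := h3.dvd_of_dvd_pow (n := 2) ⟨ε * p * d, by rw [hNd]; ring⟩
  have hM : 3 * M ^ 2 = ε * p * d := by linarith
  have h3d : (3 : ℤ) ∣ d := by
    have : (3 : ℤ) ∣ ε * p * d := ⟨M ^ 2, hM.symm⟩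
    rcases h3.dvd_or_dvd this with h' | h'
    · rcases h3.dvd_or_dvd h' with h' | h'
      · exact absurd h' h3ε
      · exact absurd h' h3p
    · exact h'
  obtain ⟨d', rfl⟩ := h3d
  have hq : 2 ≤ 3 ^ k := by
    calc 2 ≤ 3 ^ 1 := by norm_num
      _ ≤ 3 ^ k := Nat.pow_le_pow_right (by norm_num) (Nat.one_le_iff_ne_zero.mpr hk)
  obtain ⟨e, he⟩ := Nat.exists_eq_add_of_le hq
  -- Since `3 ^ k = 2 + e` and `x ^ 2 = 3 d'`, the power `x ^ 3 ^ k` vanishes modulo `3`; being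
  -- fixed modulo `3`, so does `x`, with quotient `y`. Integrality of `y ^ 2 = d' / 3` then yields a
  -- further factor `3`.
  set y : ℂ := d' * x ^ e - z with hy
  have hyint : IsIntegral ℤ y := ((isIntegral_algebraMap (x := d')).mul (hx.pow e)).sub hz
  have hxy : x = 3 * y := by
    have : x ^ 3 ^ k = (3 * d' : ℂ) * x ^ e := by
      rw [he, pow_add, hxd]; push_cast; ring
    rw [hy]
    linear_combination this - hxz
  have hy2 : y ^ 2 = ((d' / 3 : ℚ) : ℂ) := by
    push_cast
    rw [hxy] at hxd
    push_cast at hxd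
    linear_combination hxd / 9
  obtain ⟨c, hc⟩ := Complex.exists_int_eq_of_isIntegral_ratCast (hy2 ▸ hyint.pow 2)
  have hd' : d' = 3 * c := by
    have : (d' : ℚ) = 3 * c := by rw [← hc]; ring
    exact_mod_cast this
  subst hd'
  have hM' : M ^ 2 = 3 * (ε * p * c) := by linarith
  obtain ⟨M', rfl⟩ : (3 : ℤ) ∣ M := h3.dvd_of_dvd_pow ⟨_, hM'⟩
  have hpM : (p : ℤ) ∣ M' := by
    have h1 : (p : ℤ) ∣ (3 * M') ^ 2 := ⟨3 * ε * c, by rw [hM']; ring⟩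
    rcases hpz.dvd_or_dvd (hpz.dvd_of_dvd_pow h1) with h' | h'
    · exfalso
      have : p ∣ 3 := by exact_mod_cast h'
      exact hp3 ((Nat.prime_dvd_prime_iff_eq hp Nat.prime_three).mp this)
    · exact h'
  obtain ⟨t, rfl⟩ := hpM
  have ht : t ≠ 0 := by rintro rfl; simp at hN0
  have hppos : (0 : ℤ) < p := by exact_mod_cast hp.pos
  have : (9 : ℤ) * p ≤ |3 * (3 * (p * t))| := by
    have ht1 : 1 ≤ |t| := Int.one_le_abs ht
    simp only [abs_mul, Nat.abs_cast]
    norm_num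
    nlinarith
  omega

end IsFrobeniusFixed

/-! ### Fixed-point-free elements of prime power order -/

open MulAction in
/-- A transitive group of degree `c * p` with `c < p` contains a fixed-point-free element of
`p`-power order. -/
theorem MulAction.exists_pow_prime_eq_one_fixedBy_eq_empty {G Ω : Type*} [Group G] [Finite G]
    [MulAction G Ω] [IsPretransitive G Ω] {p c : ℕ} (hp : p.Prime) (hc0 : c ≠ 0) (hc : c < p)
    (hΩ : Nat.card Ω = c * p) :
    ∃ (g : G) (j : ℕ), g ^ p ^ j = 1 ∧ fixedBy Ω g = ∅ := by
  classical
  have : Fact p.Prime := ⟨hp⟩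
  have hpos : 0 < Nat.card Ω := by rw [hΩ]; exact Nat.mul_pos (Nat.pos_of_ne_zero hc0) hp.pos
  have : Finite Ω := (Nat.card_pos_iff.mp hpos).2
  have := Fintype.ofFinite Ω
  obtain ⟨P⟩ : Nonempty (Sylow p G) := inferInstance
  have := Fintype.ofFinite P
  by_contra! hcon
  -- The number of fixed points is divisible by `p`, as `|Ω|` is, and nonzero by assumption.
  have hfix (g : P) : p ≤ Fintype.card (fixedBy Ω g) := by
    obtain ⟨j, hj⟩ := P.2 g
    have hne := hcon g j (by simpa using congrArg Subtype.val hj)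
    have hz : IsPGroup p (Subgroup.zpowers g) := P.2.to_subgroup _
    have hmod := hz.card_modEq_card_fixedPoints Ω
    have heq : fixedPoints (Subgroup.zpowers g) Ω = fixedBy Ω g := by
      ext a
      simp only [mem_fixedPoints, mem_fixedBy]
      constructor
      · intro h
        exact h ⟨g, Subgroup.mem_zpowers g⟩
      · rintro h ⟨x, hx⟩
        have : Subgroup.zpowers g ≤ stabilizer P a := by
          rw [Subgroup.zpowers_le]; exact h
        exact this hx
    rw [heq, hΩ, Nat.card_eq_fintype_card] at hmod
    have hd : p ∣ Fintype.card (fixedBy Ω g) :=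
      (Nat.modEq_zero_iff_dvd.mp (hmod.symm.trans (Nat.modEq_zero_iff_dvd.mpr ⟨c, by ring⟩)))
    refine Nat.le_of_dvd (Fintype.card_pos_iff.mpr ?_) hd
    exact hne.to_subtype
  -- A point fixed by `P` would have a stabilizer of index prime to `p`, but that index is `c * p`.
  have horb (a : Ω) : p ≤ Nat.card (orbit P a) := by
    obtain ⟨n, hn⟩ := P.2.card_orbit a
    rcases Nat.eq_zero_or_pos n with rfl | hn0
    · exfalso
      rw [pow_zero] at hn
      have hle : (P : Subgroup G) ≤ stabilizer G a := by
        intro g hg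
        have hsub : Subsingleton (orbit P a) := (Nat.card_eq_one_iff_unique.mp hn).1
        have := hsub.elim ⟨(⟨g, hg⟩ : P) • a, mem_orbit _ _⟩ ⟨a, mem_orbit_self a⟩
        exact congrArg Subtype.val this
      have h1 : (stabilizer G a).index ∣ (P : Subgroup G).index := Subgroup.index_dvd_of_le hle
      rw [index_stabilizer_of_transitive, hΩ] at h1
      exact P.not_dvd_index ((Dvd.intro_left c rfl).trans h1)
    · rw [hn]
      exact Nat.le_self_pow hn0.ne' p
  have := Fintype.ofFinite (orbitRel.Quotient P Ω)
  have hcount : Fintype.card (orbitRel.Quotient P Ω) ≤ c := by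
    have h1 : Nat.card Ω = ∑ ω : orbitRel.Quotient P Ω, Nat.card (orbitRel.Quotient.orbit ω) := by
      rw [Nat.card_congr (selfEquivSigmaOrbits' P Ω), Nat.card_sigma]
    have h2 : ∑ _ω : orbitRel.Quotient P Ω, p ≤
        ∑ ω : orbitRel.Quotient P Ω, Nat.card (orbitRel.Quotient.orbit ω) := by
      refine Finset.sum_le_sum fun ω _ => ?_
      induction ω using Quotient.inductionOn'
      exact horb _
    rw [← h1, hΩ, Finset.sum_const, smul_eq_mul, Finset.card_univ] at h2
    exact Nat.le_of_mul_le_mul_right h2 hp.pos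
  -- By Burnside the average number of fixed points on `P` is the number of orbits, at most `c < p`,
  -- against `hfix`.
  have hburn : _ = Fintype.card (orbitRel.Quotient P Ω) * _ := sum_card_fixedBy_eq_card_orbits_mul_card_group P Ω
  have hge : ∑ _g : P, p ≤ ∑ g : P, Fintype.card (fixedBy Ω g) :=
    Finset.sum_le_sum fun g _ => hfix g
  rw [hburn, Finset.sum_const, smul_eq_mul, Finset.card_univ, mul_comm] at hge
  have := Nat.le_of_mul_le_mul_right hge Fintype.card_pos
  omega

/-! ### Multiplicity-free sums of irreducible representations -/

namespace Representation

section Coprod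

variable {k G U V W : Type*} [Field k] [Monoid G] [AddCommGroup U] [Module k U]
  [AddCommGroup V] [Module k V] [AddCommGroup W] [Module k W]
  {ρ : Representation k G U} {σ : Representation k G W} {τ : Representation k G V}

/-- An embedding and a nonzero map from an irreducible representation that does not map to its
source are jointly injective. -/
theorem IntertwiningMap.coprod_injective [σ.IsIrreducible] (φ : IntertwiningMap ρ τ)
    (ψ : IntertwiningMap σ τ) (hφ : Function.Injective φ) (hψ : ψ ≠ 0)
    (hσρ : ∀ f : IntertwiningMap σ ρ, f = 0) :
    Function.Injective (φ.toLinearMap.coprod ψ.toLinearMap) := by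
  have hψi : Function.Injective ψ := (IsIrreducible.injective_or_eq_zero ψ).resolve_right hψ
  -- If the part of `σ` landing in the image of `φ` is zero, the two images are independent; if it
  -- is everything, `ψ` factors through `φ` and gives a nonzero map `σ → ρ`.
  let S : Subrepresentation σ :=
    ⟨(LinearMap.range φ.toLinearMap).comap ψ.toLinearMap, by
      rintro g v ⟨u, hu⟩
      refine ⟨ρ g u, ?_⟩
      change φ u = ψ v at hu
      change φ (ρ g u) = ψ (σ g v)
      rw [φ.isIntertwining, ψ.isIntertwining, hu]⟩
  rcases IsSimpleOrder.eq_bot_or_eq_top S with hS | hS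
  · rw [injective_iff_map_eq_zero]
    rintro ⟨u, w⟩ h
    change φ u + ψ w = 0 at h
    have hw : w ∈ S := ⟨-u, by
      change φ (-u) = ψ w
      rw [← sub_eq_zero, map_neg, ← neg_add', h, neg_zero]⟩
    rw [hS] at hw
    have hw0 : w = 0 := hw
    subst hw0
    rw [map_zero, add_zero] at h
    rw [hφ (h.trans (map_zero φ).symm)]
    rfl
  · exfalso
    have hmem (w : W) : ψ w ∈ LinearMap.range φ.toLinearMap := by
      have : w ∈ S := by rw [hS]; trivial
      exact this
    let e := LinearEquiv.ofInjective φ.toLinearMap hφ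
    let f : W →ₗ[k] U := e.symm.toLinearMap ∘ₗ ψ.toLinearMap.codRestrict _ hmem
    have hf (w : W) : φ (f w) = ψ w :=
      congrArg Subtype.val (e.apply_symm_apply (ψ.toLinearMap.codRestrict _ hmem w))
    have hf0 := hσρ (f.intertwiningMap_of_isIntertwiningMap σ ρ fun g v => hφ (by
      rw [hf, φ.isIntertwining, hf, ψ.isIntertwining]))
    apply hψ
    ext w
    change ψ w = 0
    have : f w = 0 := congrArg (fun F : IntertwiningMap σ ρ => F w) hf0
    rw [← hf, this, map_zero]

theorem IntertwiningMap.hasEigenvalue {A : Module.End k V} {c : k} (φ : IntertwiningMap ρ τ)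
    (hφ : φ ≠ 0) (hc : ∀ u, A (φ u) = c • φ u) : A.HasEigenvalue c := by
  obtain ⟨u, hu⟩ : ∃ u, φ u ≠ 0 := by
    by_contra! hcon
    exact hφ (IntertwiningMap.ext (LinearMap.ext hcon))
  exact Module.End.hasEigenvalue_of_hasEigenvector ⟨Module.End.mem_eigenspace_iff.mpr (hc u), hu⟩

end Coprod

variable {G V W₁ W₂ : Type*} [Group G] [Finite G] [AddCommGroup V] [Module ℂ V]
  [FiniteDimensional ℂ V] [AddCommGroup W₁] [Module ℂ W₁] [FiniteDimensional ℂ W₁]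
  [AddCommGroup W₂] [Module ℂ W₂] [FiniteDimensional ℂ W₂]

omit [Finite G] [FiniteDimensional ℂ W₁] [FiniteDimensional ℂ W₂] in
theorem IntertwiningMap.eq_zero_of_character_ne {ρ : Representation ℂ G W₁}
    {σ : Representation ℂ G W₂} [ρ.IsIrreducible] [σ.IsIrreducible]
    (h : ρ.character ≠ σ.character) (f : IntertwiningMap ρ σ) : f = 0 := by
  have : IsEmpty (Equiv ρ σ) := ⟨fun e => h (char_iso e)⟩
  exact Subsingleton.elim _ _

omit [Finite G] in
theorem character_trivial_self : (trivial ℂ G ℂ).character = 1 := by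
  ext g
  have : trivial ℂ G ℂ g = LinearMap.id := rfl
  rw [character, this, LinearMap.trace_id]
  simp

omit [Finite G] in
theorem isIrreducible_trivial_self : (trivial ℂ G ℂ).IsIrreducible where
  exists_pair_ne := ⟨⊥, ⊤, fun h => by
    have : (1 : ℂ) ∈ (⊥ : Subrepresentation (trivial ℂ G ℂ)) := by rw [h]; exact Submodule.mem_top
    exact one_ne_zero (α := ℂ) this⟩
  eq_bot_or_eq_top S := by
    rcases eq_bot_or_eq_top S.toSubmodule with h | h
    · exact Or.inl (Subrepresentation.toSubmodule_injective h)
    · exact Or.inr (Subrepresentation.toSubmodule_injective h)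

/-- The intertwining maps from an irreducible constituent of multiplicity one. -/
theorem exists_intertwiningMap_of_character_eq {τ : Representation ℂ G V}
    {ρ : Representation ℂ G W₁} {σ : Representation ℂ G W₂} [ρ.IsIrreducible] [σ.IsIrreducible]
    (h : τ.character = 1 + ρ.character + σ.character) (h1 : ρ.character ≠ 1)
    (hne : ρ.character ≠ σ.character) :
    ∃ φ : IntertwiningMap ρ τ, φ ≠ 0 ∧ ∀ f : IntertwiningMap ρ τ, ∃ c : ℂ, c • φ = f := by
  classical
  have := Fintype.ofFinite G
  have : Invertible (Nat.card G : ℂ) := invertibleOfNonzero (by exact_mod_cast Nat.card_pos.ne')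
  have := isIrreducible_trivial_self (G := G)
  have hcard := card_inv_mul_sum_char_mul_char_eq_finrank ρ τ
  have e1 : IsEmpty (ρ.Equiv (trivial ℂ G ℂ)) :=
    ⟨fun e => h1 ((char_iso e).trans character_trivial_self)⟩
  have e2 : IsEmpty (ρ.Equiv σ) := ⟨fun e => hne (char_iso e)⟩
  have hT := char_orthonormal (trivial ℂ G ℂ) ρ
  have hρ := char_orthonormal ρ ρ
  have hσ := char_orthonormal σ ρ
  rw [if_neg (not_nonempty_iff.mpr e1), character_trivial_self] at hT
  rw [if_pos ⟨Equiv.refl ρ⟩] at hρ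
  rw [if_neg (not_nonempty_iff.mpr e2)] at hσ
  have hfin : Module.finrank ℂ (IntertwiningMap ρ τ) = 1 := by
    have : (Module.finrank ℂ (IntertwiningMap ρ τ) : ℂ) = 1 := by
      rw [← hcard, h]
      simp only [Pi.add_apply, add_mul, Finset.sum_add_distrib, mul_add]
      rw [hT, hρ, hσ]
      simp
    exact_mod_cast this
  obtain ⟨φ, hφ, hall⟩ := finrank_eq_one_iff'.mp hfin
  exact ⟨φ, hφ, hall⟩

/-- An endomorphism of a representation `1 ⊕ ρ ⊕ σ` without multiplicities acts on the three
summands as scalars. -/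
theorem exists_trace_pow_mul_eq {τ : Representation ℂ G V}
    {ρ : Representation ℂ G W₁} {σ : Representation ℂ G W₂} [ρ.IsIrreducible] [σ.IsIrreducible]
    (h : τ.character = 1 + ρ.character + σ.character) (hρ : ρ.character ≠ 1)
    (hσ : σ.character ≠ 1) (hne : ρ.character ≠ σ.character)
    {v : V} (hv : v ≠ 0) (hτv : ∀ g, τ g v = v) {A : Module.End ℂ V}
    (hA : ∀ g, A ∘ₗ τ g = τ g ∘ₗ A) {a : ℂ} (hAv : A v = a • v) :
    ∃ r s : ℂ, A.HasEigenvalue r ∧ A.HasEigenvalue s ∧ ∀ (j : ℕ) (g : G),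
      LinearMap.trace ℂ V (A ^ j * τ g) =
        a ^ j + r ^ j * ρ.character g + s ^ j * σ.character g := by
  have := isIrreducible_trivial_self (G := G)
  obtain ⟨φ₁, hφ₁, hall₁⟩ := exists_intertwiningMap_of_character_eq h hρ hne
  obtain ⟨φ₂, hφ₂, hall₂⟩ := exists_intertwiningMap_of_character_eq
    (ρ := σ) (σ := ρ) (h.trans (add_right_comm _ _ _)) hσ hne.symm
  let φ₀ : IntertwiningMap (trivial ℂ G ℂ) τ :=
    (LinearMap.toSpanSingleton ℂ V v).intertwiningMap_of_isIntertwiningMap _ _ fun g c => by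
      change c • v = τ g (c • v)
      rw [map_smul, hτv]
  have hφ₀ : Function.Injective φ₀ := smul_left_injective ℂ hv
  have h01 := IntertwiningMap.coprod_injective φ₀ φ₁ hφ₀ hφ₁
    (IntertwiningMap.eq_zero_of_character_ne (by rwa [character_trivial_self]))
  let φ₀₁ : IntertwiningMap ((trivial ℂ G ℂ).prod ρ) τ :=
    (φ₀.toLinearMap.coprod φ₁.toLinearMap).intertwiningMap_of_isIntertwiningMap _ _ fun g w => by
      change φ₀ (trivial ℂ G ℂ g w.1) + φ₁ (ρ g w.2) = τ g (φ₀ w.1 + φ₁ w.2)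
      rw [φ₀.isIntertwining, φ₁.isIntertwining, map_add]
  have h012 := IntertwiningMap.coprod_injective φ₀₁ φ₂ h01 hφ₂ fun f => by
    have f1 := IntertwiningMap.eq_zero_of_character_ne (by rwa [character_trivial_self])
      ((IntertwiningMap.fst ℂ (trivial ℂ G ℂ) ρ).comp f)
    have f2 := IntertwiningMap.eq_zero_of_character_ne hne.symm
      ((IntertwiningMap.snd ℂ (trivial ℂ G ℂ) ρ).comp f)
    ext w
    · exact congrArg (fun F : IntertwiningMap σ (trivial ℂ G ℂ) => F w) f1
    · exact congrArg (fun F : IntertwiningMap σ ρ => F w) f2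
  have hdim : Module.finrank ℂ ((ℂ × W₁) × W₂) = Module.finrank ℂ V := by
    have := congrFun h 1
    simp only [Pi.add_apply, char_one, Pi.one_apply] at this
    simp only [Module.finrank_prod, Module.finrank_self]
    exact_mod_cast this.symm
  -- The dimensions agree by comparing characters at `1`.
  let Φ := LinearEquiv.ofInjectiveOfFinrankEq
    (φ₀₁.toLinearMap.coprod φ₂.toLinearMap) h012 hdim
  have hΦ (w : (ℂ × W₁) × W₂) : Φ w = w.1.1 • v + φ₁ w.1.2 + φ₂ w.2 := rfl
  -- `A ∘ φ₁` is again intertwining, hence a multiple of `φ₁` by multiplicity one.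
  obtain ⟨r, hr⟩ := hall₁ ((A ∘ₗ φ₁.toLinearMap).intertwiningMap_of_isIntertwiningMap ρ τ
    fun g w => by
      change A (φ₁ (ρ g w)) = τ g (A (φ₁ w))
      rw [φ₁.isIntertwining]
      exact LinearMap.congr_fun (hA g) _)
  obtain ⟨s, hs⟩ := hall₂ ((A ∘ₗ φ₂.toLinearMap).intertwiningMap_of_isIntertwiningMap σ τ
    fun g w => by
      change A (φ₂ (σ g w)) = τ g (A (φ₂ w))
      rw [φ₂.isIntertwining]
      exact LinearMap.congr_fun (hA g) _)
  replace hr (w : W₁) : A (φ₁ w) = r • φ₁ w :=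
    (congrArg (fun F : IntertwiningMap ρ τ => F w) hr).symm
  replace hs (w : W₂) : A (φ₂ w) = s • φ₂ w :=
    (congrArg (fun F : IntertwiningMap σ τ => F w) hs).symm
  refine ⟨r, s, φ₁.hasEigenvalue hφ₁ hr, φ₂.hasEigenvalue hφ₂ hs, fun j g => ?_⟩
  let D (g : G) : Module.End ℂ ((ℂ × W₁) × W₂) :=
    ((a ^ j • LinearMap.id).prodMap (r ^ j • ρ g)).prodMap (s ^ j • σ g)
  have hpow {c : ℂ} {u : V} (hu : A u = c • u) : (A ^ j) u = c ^ j • u := by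
    induction j with
    | zero => simp
    | succ j ih => rw [pow_succ', Module.End.mul_apply, ih, map_smul, hu, smul_smul, pow_succ]
  have hconj : A ^ j * τ g = Φ.conj (D g) := by
    rw [LinearEquiv.conj_apply]
    ext x
    obtain ⟨w, rfl⟩ := Φ.surjective x
    simp only [LinearMap.comp_apply, LinearEquiv.coe_coe, Φ.symm_apply_apply,
      Module.End.mul_apply]
    simp only [hΦ, D, LinearMap.prodMap_apply, LinearMap.smul_apply, LinearMap.id_apply]
    simp only [map_add, map_smul, hτv, ← φ₁.isIntertwining, ← φ₂.isIntertwining]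
    rw [hpow hAv, hpow (hr _), hpow (hs _)]
    simp only [smul_eq_mul, mul_smul, smul_comm w.1.1]
  rw [hconj, LinearMap.trace_conj', LinearMap.trace_prodMap', LinearMap.trace_prodMap']
  simp only [map_smul, LinearMap.trace_id, Module.finrank_self, smul_eq_mul, Nat.cast_one, mul_one]
  rfl

end Representation

/-! ### Permutation representations and orbital matrices -/

section PermutationRepresentation

variable (G Ω : Type*) [Group G] [MulAction G Ω]

/-- The permutation representation on complex functions. -/
noncomputable def Representation.onFunctions : Representation ℂ G (Ω → ℂ) where
  toFun g := LinearMap.funLeft ℂ ℂ fun x => g⁻¹ • x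
  map_one' := by ext; simp [LinearMap.funLeft]
  map_mul' g h := by
    refine LinearMap.ext fun f => funext fun x => ?_
    simp [LinearMap.funLeft_apply, mul_smul]

variable {G Ω}

theorem Representation.onFunctions_apply (g : G) (f : Ω → ℂ) (x : Ω) :
    onFunctions G Ω g f x = f (g⁻¹ • x) := rfl

theorem Representation.character_ofMulAction [Finite Ω] :
    (ofMulAction ℂ G Ω).character = (onFunctions G Ω).character := by
  let e : MonoidAlgebra ℂ Ω ≃ₗ[ℂ] (Ω → ℂ) :=
    (MonoidAlgebra.coeffLinearEquiv ℂ).trans (Finsupp.linearEquivFunOnFinite ℂ ℂ Ω)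
  refine char_iso (Equiv.mk e fun g => ?_)
  refine LinearMap.ext fun f => funext fun x => ?_
  exact coeff_ofMulAction g f x

variable [Fintype Ω] [DecidableEq Ω]

/-- For the `0`-`1` matrix of an orbital this trace counts the `x` with `(x, g • x)` in the orbital.
-/
theorem Representation.trace_toLin'_mul_onFunctions (M : Matrix Ω Ω ℂ) (g : G) :
    LinearMap.trace ℂ (Ω → ℂ) (Matrix.toLin' M * onFunctions G Ω g) = ∑ x, M x (g • x) := by
  have hg : onFunctions G Ω g = Matrix.toLin'
      (Matrix.of fun x y => if y = g⁻¹ • x then 1 else 0) := by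
    refine LinearMap.ext fun f => funext fun x => ?_
    simp [onFunctions_apply, Matrix.mulVec, dotProduct]
  rw [hg, Module.End.mul_eq_comp, ← Matrix.toLin'_mul, Matrix.trace_toLin'_eq]
  simp [Matrix.trace, Matrix.mul_apply, eq_inv_smul_iff, eq_comm]

theorem Representation.toLin'_comp_onFunctions {M : Matrix Ω Ω ℂ}
    (hM : ∀ (g : G) x y, M (g • x) (g • y) = M x y) (g : G) :
    Matrix.toLin' M ∘ₗ onFunctions G Ω g = onFunctions G Ω g ∘ₗ Matrix.toLin' M := by
  refine LinearMap.ext fun f => funext fun x => ?_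
  simp only [LinearMap.comp_apply, onFunctions_apply, Matrix.toLin'_apply, Matrix.mulVec,
    dotProduct]
  rw [← Equiv.sum_comp (MulAction.toPerm g)]
  refine Finset.sum_congr rfl fun y _ => ?_
  simp only [MulAction.toPerm_apply, inv_smul_smul]
  rw [← hM g⁻¹, inv_smul_smul]

theorem Representation.character_onFunctions_eq_zero {g : G} (hg : MulAction.fixedBy Ω g = ∅) :
    (onFunctions G Ω).character g = 0 := by
  have h := trace_toLin'_mul_onFunctions (1 : Matrix Ω Ω ℂ) g
  rw [Matrix.toLin'_one] at h
  refine h.trans (Finset.sum_eq_zero fun x _ => Matrix.one_apply_ne' fun hx => ?_)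
  have : x ∈ MulAction.fixedBy Ω g := hx
  rw [hg] at this
  exact this

omit [DecidableEq Ω] in
/-- A transitive action which is not `2`-transitive has an invariant `0`-`1` matrix with zero
diagonal, which is symmetric or disjoint from its transpose, and is neither zero nor the full
off-diagonal matrix. -/
theorem MulAction.exists_orbital_matrix [IsPretransitive G Ω]
    (h : ¬ IsMultiplyPretransitive G Ω 2) :
    ∃ (M : Matrix Ω Ω ℤ) (k : ℤ), (∀ x y, M x y = 0 ∨ M x y = 1) ∧ (∀ x, M x x = 0) ∧
      (∀ (g : G) x y, M (g • x) (g • y) = M x y) ∧ (∀ x, ∑ y, M x y = k) ∧ 0 < k ∧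
      k + 1 < Fintype.card Ω ∧
      ((M * M).trace = Fintype.card Ω * k ∨ (M * M).trace = 0) := by
  classical
  rw [is_two_pretransitive_iff] at h
  push Not at h
  obtain ⟨a, b, c, d, hab, hcd, hno⟩ := h
  -- The orbital of `(a, b)`; it misses `(c, d)`, so row `c` has zeros at both `c` and `d`, whence
  -- `k + 1 < |Ω|`.
  let R (x y : Ω) : Prop := ∃ g : G, g • a = x ∧ g • b = y
  have hRg (g : G) {x y : Ω} (hxy : R x y) : R (g • x) (g • y) := by
    obtain ⟨h, rfl, rfl⟩ := hxy
    exact ⟨g * h, mul_smul _ _ _, mul_smul _ _ _⟩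
  have hRg' (g : G) (x y : Ω) : R (g • x) (g • y) ↔ R x y :=
    ⟨fun hxy => by simpa using hRg g⁻¹ hxy, hRg g⟩
  have hRne {x y : Ω} (hxy : R x y) : x ≠ y := by
    obtain ⟨h, rfl, rfl⟩ := hxy
    simpa using hab
  have hRsymm (hba : R b a) {x y : Ω} (hxy : R x y) : R y x := by
    obtain ⟨h, rfl, rfl⟩ := hxy
    exact hRg h hba
  have hRasymm {x y : Ω} (hxy : R x y) (hyx : R y x) : R b a := by
    obtain ⟨h, rfl, rfl⟩ := hxy
    exact (hRg' h b a).mp hyx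
  have hRab : R a b := ⟨1, one_smul _ _, one_smul _ _⟩
  let M : Matrix Ω Ω ℤ := Matrix.of fun x y => if R x y then 1 else 0
  have hM (x y : Ω) : M x y = if R x y then 1 else 0 := rfl
  have hMg (g : G) (x y : Ω) : M (g • x) (g • y) = M x y := by simp only [hM, hRg']
  have hsum (x : Ω) : ∑ y, M x y = ∑ y, M c y := by
    obtain ⟨g, rfl⟩ := exists_smul_eq G c x
    rw [← Equiv.sum_comp (MulAction.toPerm g)]
    simp only [MulAction.toPerm_apply, hMg]
  refine ⟨M, ∑ y, M c y, fun x y => ?_, fun x => ?_, hMg, hsum, ?_, ?_, ?_⟩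
  · rw [hM]; split_ifs <;> simp
  · rw [hM, if_neg fun hx => hRne hx rfl]
  · rw [← hsum a]
    refine Finset.sum_pos' (fun y _ => ?_) ⟨b, Finset.mem_univ _, ?_⟩
    · rw [hM]; split_ifs <;> simp
    · rw [hM, if_pos hRab]; exact one_pos
  · have hcard : ∑ y, M c y ≤ ((Finset.univ.erase c).erase d).card := by
      rw [Finset.card_eq_sum_ones]
      push_cast
      rw [← Finset.sum_subset (Finset.subset_univ ((Finset.univ.erase c).erase d))]
      · refine Finset.sum_le_sum fun y _ => ?_
        rw [hM]; split_ifs <;> simp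
      · intro y _ hy
        rw [hM, if_neg]
        intro hcy
        have hyd : y = d := by
          by_contra hyd
          exact hy (by simp [hyd, (hRne hcy).symm])
        subst hyd
        obtain ⟨g, hg⟩ := hcy
        exact hno g hg.1 hg.2
    rw [Finset.card_erase_of_mem (by simp [hcd.symm]), Finset.card_erase_of_mem (by simp),
      Finset.card_univ] at hcard
    have : 1 < Fintype.card Ω := Fintype.one_lt_card_iff.mpr ⟨a, b, hab⟩
    omega
  · have htr : (M * M).trace = ∑ x, ∑ y, M x y * M y x := rfl
    rw [htr]
    -- A self-paired orbital has a symmetric matrix; otherwise it is disjoint from its transpose.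
    by_cases hba : R b a
    · left
      have : ∀ x, ∑ y, M x y * M y x = ∑ y, M c y := fun x => by
        rw [← hsum x]
        refine Finset.sum_congr rfl fun y _ => ?_
        simp only [hM]
        by_cases hxy : R x y
        · rw [if_pos hxy, if_pos (hRsymm hba hxy), mul_one]
        · rw [if_neg hxy, zero_mul]
      simp [this]
    · right
      refine Finset.sum_eq_zero fun x _ => Finset.sum_eq_zero fun y _ => ?_
      simp only [hM]
      by_cases hxy : R x y
      · rw [if_neg fun hyx => hba (hRasymm hxy hyx), mul_zero]
      · rw [if_neg hxy, zero_mul]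

end PermutationRepresentation

/-! ### Eigenvalues of the orbital matrix and the contradiction -/

theorem Matrix.isIntegral_of_hasEigenvalue {n : Type*} [Fintype n] [DecidableEq n]
    {M : Matrix n n ℤ} {r : ℂ}
    (hr : Module.End.HasEigenvalue (Matrix.toLin' (M.map (Int.cast : ℤ → ℂ))) r) :
    IsIntegral ℤ r := by
  refine ⟨M.charpoly, M.charpoly_monic, ?_⟩
  rw [Module.End.hasEigenvalue_iff_isRoot_charpoly, Matrix.charpoly_toLin'] at hr
  have h : (M.map (Int.cast : ℤ → ℂ)).charpoly = M.charpoly.map (Int.castRingHom ℂ) :=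
    Matrix.charpoly_map M (Int.castRingHom ℂ)
  rw [h, Polynomial.IsRoot, Polynomial.eval_map] at hr
  exact hr

theorem mainTheorem7 {Ω : Type*} (p : ℕ) (hp : p.Prime) (hp5 : 5 ≤ p)
    (hΩ : Nat.card Ω = 3 * p) (G : Subgroup (Equiv.Perm Ω))
    (hprim : MulAction.IsPreprimitive G Ω)
    (hnot : ¬ MulAction.IsMultiplyPretransitive G Ω 2) :
    ¬ ∃ χ₁ χ₂ : G → ℂ,
      IsIrreducibleCharacter χ₁ ∧ IsIrreducibleCharacter χ₂ ∧
      χ₁ 1 = (3 * (p : ℂ) - 1) / 2 ∧ χ₂ 1 = (3 * (p : ℂ) - 1) / 2 ∧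
      permutationCharacter G = 1 + χ₁ + χ₂ := by
  classical
  rintro ⟨_, _, ⟨n₁, ρ₁, hρ₁, rfl⟩, ⟨n₂, ρ₂, hρ₂, rfl⟩, hdeg₁, hdeg₂, hπ⟩
  have : Finite Ω := (Nat.card_pos_iff.mp (by rw [hΩ]; omega)).2
  have := Fintype.ofFinite Ω
  have hcard : Fintype.card Ω = 3 * p := by rw [← hΩ, Nat.card_eq_fintype_card]
  have htrans : MulAction.IsPretransitive G Ω := hprim.toIsPretransitive
  obtain ⟨g, j, hgj, hg⟩ := MulAction.exists_pow_prime_eq_one_fixedBy_eq_empty (G := G)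
    hp three_ne_zero (by omega) hΩ
  rw [permutationCharacter, Representation.character_ofMulAction] at hπ
  have hp3 : p ≠ 3 := by omega
  set m := p ^ j with hm
  have hm0 : m ≠ 0 := pow_ne_zero _ hp.ne_zero
  have hcop : Nat.Coprime 3 m :=
    Nat.Coprime.pow_right _ ((Nat.coprime_primes Nat.prime_three hp).mpr hp3.symm)
  have hF₁ : IsFrobeniusFixed (3 ^ m.totient) (ρ₁.character g) :=
    .trace hm0 (by rw [← map_pow, hgj, map_one]) (Nat.ModEq.pow_totient hcop)
  have hF₂ : IsFrobeniusFixed (3 ^ m.totient) (ρ₂.character g) :=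
    .trace hm0 (by rw [← map_pow, hgj, map_one]) (Nat.ModEq.pow_totient hcop)
  have hsum : 1 + ρ₁.character g + ρ₂.character g = 0 := by
    rw [← Representation.character_onFunctions_eq_zero hg, hπ]
    rfl
  -- Equal characters would take the value `-1/2` at `g`, which is not an algebraic integer.
  by_cases hne : ρ₁.character = ρ₂.character
  · rw [← hne] at hsum
    have hhalf : ρ₁.character g = ((-1 / 2 : ℚ) : ℂ) := by
      push_cast
      linear_combination hsum / 2
    obtain ⟨d, hd⟩ := Complex.exists_int_eq_of_isIntegral_ratCast (hhalf ▸ hF₁.1)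
    have : (2 * d : ℚ) = -1 := by rw [← hd]; norm_num
    have : 2 * d = -1 := by exact_mod_cast this
    omega
  have hone {n : ℕ} {ρ : Representation ℂ G (Fin n → ℂ)}
      (hdeg : ρ.character 1 = (3 * (p : ℂ) - 1) / 2) : ρ.character ≠ 1 := by
    intro h
    rw [h, Pi.one_apply] at hdeg
    have : (3 * p : ℂ) = 3 := by linear_combination -2 * hdeg
    have : 3 * p = 3 := by exact_mod_cast this
    omega
  obtain ⟨M, k, hM01, hMdiag, hMg, hMrow, hk0, hkn, hMM⟩ :=
    MulAction.exists_orbital_matrix (G := G) (Ω := Ω) hnot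
  rw [hcard] at hkn hMM
  have hconst : (fun _ : Ω => (1 : ℂ)) ≠ 0 := by
    have : Nonempty Ω := Fintype.card_pos_iff.mp (by omega)
    exact fun h => one_ne_zero (congrFun h (Classical.arbitrary Ω))
  obtain ⟨r, s, hr, hs, htr⟩ := Representation.exists_trace_pow_mul_eq hπ
    (hone hdeg₁) (hone hdeg₂) hne hconst (fun _ => rfl)
    (Representation.toLin'_comp_onFunctions (M := M.map (Int.cast : ℤ → ℂ))
      fun g x y => by simp only [Matrix.map_apply, hMg]) (a := (k : ℂ)) (by
        refine funext fun x => ?_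
        simp only [Matrix.toLin'_apply, Matrix.mulVec, dotProduct, Matrix.map_apply, mul_one,
          Pi.smul_apply, smul_eq_mul]
        exact_mod_cast hMrow x)
  have hrint := Matrix.isIntegral_of_hasEigenvalue hr
  have hsint := Matrix.isIntegral_of_hasEigenvalue hs
  have htrace₁ (h : G) : ((∑ x, M x (h • x) : ℤ) : ℂ) =
      k + r * ρ₁.character h + s * ρ₂.character h := by
    have := htr 1 h
    rw [pow_one, Representation.trace_toLin'_mul_onFunctions, pow_one, pow_one, pow_one] at this
    rw [← this]
    push_cast
    rfl
  have htrace₂ : (((M * M).trace : ℤ) : ℂ) =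
      k ^ 2 + r ^ 2 * ρ₁.character 1 + s ^ 2 * ρ₂.character 1 := by
    rw [← htr 2 1, map_one, mul_one, pow_two, Module.End.mul_eq_comp, ← Matrix.toLin'_mul,
      Matrix.trace_toLin'_eq]
    simp [Matrix.trace, Matrix.mul_apply]
  have hrs1 := htrace₁ 1
  simp only [one_smul, hMdiag, Finset.sum_const_zero, hdeg₁, hdeg₂, Int.cast_zero] at hrs1
  have hn1 : (3 * p - 1 : ℂ) ≠ 0 := by
    intro h
    have : (3 * p : ℂ) = 1 := by linear_combination h
    have : 3 * p = 1 := by exact_mod_cast this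
    omega
  have hrs : r + s = ((-2 * k / (3 * p - 1) : ℚ) : ℂ) := by
    push_cast
    rw [eq_div_iff hn1]
    linear_combination -2 * hrs1
  obtain ⟨d, hd⟩ := Complex.exists_int_eq_of_isIntegral_ratCast (hrs ▸ hrint.add hsint)
  rw [hd] at hrs
  have hdk : d * (3 * p - 1) = -2 * k := by
    have : (d * (3 * p - 1) : ℂ) = -2 * k := by
      rw [show (d : ℂ) = r + s by rw [hrs]; simp]
      linear_combination -2 * hrs1
    exact_mod_cast this
  push_cast at hkn
  -- `0 < k < 3p - 1` puts `d = -2k/(3p - 1)` strictly between `-2` and `0`.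
  have hd1 : d = -1 := by
    have : d < 0 := by nlinarith
    have : -2 < d := by nlinarith
    omega
  subst hd1
  have hk : 2 * k = 3 * p - 1 := by linarith
  have hkc : (2 * k : ℂ) = 3 * p - 1 := by exact_mod_cast congrArg (Int.cast : ℤ → ℂ) hk
  have hrs' : r + s = -1 := by rw [hrs]; simp
  have hkc0 : (k : ℂ) ≠ 0 := by exact_mod_cast hk0.ne'
  rw [hdeg₁, hdeg₂] at htrace₂
  -- Use `(r - s)² = 2(r² + s²) - (r + s)²`; the sign `ε` is `1` when `tr M² = 3pk` and `-1` when it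
  -- is `0`.
  obtain ⟨ε, hε, hεrs⟩ : ∃ ε : ℤ, ε ^ 2 = 1 ∧ (r - s) ^ 2 = ε * (3 * p) := by
    rcases hMM with h | h
    · refine ⟨1, by norm_num, ?_⟩
      rw [h] at htrace₂
      push_cast at htrace₂
      have : (k : ℂ) * (3 * p) = k * (k + r ^ 2 + s ^ 2) := by
        linear_combination htrace₂ - (r ^ 2 + s ^ 2) / 2 * hkc
      have := mul_left_cancel₀ hkc0 this
      push_cast
      linear_combination (-2) * this - (r + s - 1) * hrs' - hkc
    · refine ⟨-1, by norm_num, ?_⟩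
      rw [h] at htrace₂
      push_cast at htrace₂
      have : (k : ℂ) * 0 = k * (k + r ^ 2 + s ^ 2) := by
        linear_combination htrace₂ - (r ^ 2 + s ^ 2) / 2 * hkc
      have := mul_left_cancel₀ hkc0 this
      push_cast
      linear_combination (-2) * this - (r + s - 1) * hrs' - hkc
  have hT := htrace₁ g
  set T : ℤ := ∑ x, M x (g • x) with hTdef
  have hT0 : 0 ≤ T := Finset.sum_nonneg fun x _ => by rcases hM01 x (g • x) with h | h <;> omega
  have hTn : T ≤ 3 * p := by
    have : T ≤ ∑ _x : Ω, (1 : ℤ) :=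
      Finset.sum_le_sum fun x _ => by rcases hM01 x (g • x) with h | h <;> omega
    simpa [hcard] using this
  -- From `2(rα + sβ) = (r + s)(α + β) + (r - s)(α - β)`, where `r + s = α + β = -1`.
  have hN : ((2 * T - 3 * p : ℤ) : ℂ) = (r - s) * (ρ₁.character g - ρ₂.character g) := by
    push_cast
    linear_combination 2 * hT + hkc + (ρ₁.character g + ρ₂.character g) * hrs' - hsum
  have hodd : p % 2 = 1 := (hp.eq_two_or_odd).resolve_left (by omega)
  -- `2T - 3p` is nonzero because `p` is odd.
  refine (hF₁.sub hF₂).false_of_sq_eq hp hp3 (Nat.totient_pos.mpr (Nat.pos_of_ne_zero hm0)).ne'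
    hε (N := 2 * T - 3 * p) (by omega) (abs_le.mpr ⟨by omega, by omega⟩) ?_
  rw [hN, mul_pow, hεrs]
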